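/- Let $G$ be a discrete group acting by homeomorphisms on a locally compact Hausdorff space $X$, and let $G$ act on $C_0(X)$ by $(t.f)(\xi)=f(t^{-1}\xi)$. Let $C_0(X)\rtimes_r G$ be the reduced crossed product, i.e. the norm closure of the $*$-algebra $C_c(G,C_0(X))$ of finite sums $\sum_{t\in G}a_tu_t$ (where $a_t\in C_0(X)$ and $u_ta=(t.a)u_t$) in the regular representation on $\ell^2(G,H)$ induced by a faithful representation of $C_0(X)$ on a Hilbert space $H$ (the choice of which is immaterial). Let $C_c(G,C_0(X)^+)$ be the set of those finite sums with all $a_t\ge 0$. Call a non-empty set $U\subseteq X$ $(G,\tau_X)$-paradoxical if there are non-empty open sets $V_1,\dots,V_{n+m}\subseteq X$ and elements $t_1,\dots,t_{n+m}\in G$ such that $\bigcup_{i=1}^{n}V_i=\bigcup_{i=n+1}^{n+m}V_i=U$ and such that $t_1.V_1,\dots,t_{n+m}.V_{n+m}$ are pairwise disjoint subsets of $U$. Call a non-zero positive element $a$ of a $C^*$-algebra $A$ properly infinite if $a\oplus a\precsim a$, i.e. if there is a sequence $(r_k)$ in $M_{1,2}(A)$ with $r_k^*ar_k\to \mathrm{diag}(a,a)$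 in $M_2(A)$. Let $U$ be a non-empty compact open subset of $X$. Then $U$ is $(G,\tau_X)$-paradoxical if and only if there exist elements $x,y$ in $C_c(G,C_0(X)^+)$ such that $x^*x=y^*y=1_U$ and $xx^*+yy^*\le 1_U$ (in $C_0(X)\rtimes_r G$). In this case $1_U$ is properly infinite in $C_0(X)\rtimes_r G$. -/

import Mathlib

open scoped ZeroAtInfty ENNReal Pointwise ComplexOrder InnerProductSpace Topology
open Filter

noncomputable section

namespace CrossedProduct

/-! ### Operators on `ℓ²(ι, H)` -/

section Operators

variable {ι H : Type*} [NormedAddCommGroup H] [InnerProductSpace ℂ H]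

/-- The Hilbert space `ℓ²(ι, H)` of square summable functions from `ι` to `H`. -/
abbrev Ell2 (ι H : Type*) [NormedAddCommGroup H] : Type _ := lp (fun _ : ι => H) 2

/-- The diagonal operator `(D ξ)(i) = T i (ξ i)` of a uniformly bounded family of operators. -/
def diagonal (T : ι → H →L[ℂ] H) {C : ℝ} (hC : 0 ≤ C) (hT : ∀ i, ‖T i‖ ≤ C) :
    Ell2 ι H →L[ℂ] Ell2 ι H :=
  lp.mapCLM 2 T hC hT

@[simp]
theorem diagonal_apply (T : ι → H →L[ℂ] H) {C : ℝ} (hC : 0 ≤ C) (hT : ∀ i, ‖T i‖ ≤ C)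
    (ξ : Ell2 ι H) (i : ι) : diagonal T hC hT ξ i = T i (ξ i) := rfl

theorem memlp_comp_equiv {ι H : Type*} [NormedAddCommGroup H] (e : ι ≃ ι) (ξ : Ell2 ι H) : Memℓp (fun i => ξ (e i)) 2 := by
  have h := lp.memℓp ξ
  rw [memℓp_gen_iff (by norm_num)] at h ⊢
  exact h.comp_injective e.injective

/-- The isometry `(L ξ)(i) = ξ (e i)` of `ℓ²(ι, H)` given by a permutation `e` of `ι`. -/
def permute (e : ι ≃ ι) : Ell2 ι H →ₗᵢ[ℂ] Ell2 ι H where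
  toFun ξ := ⟨fun i => ξ (e i), memlp_comp_equiv e ξ⟩
  map_add' _ _ := by ext; rfl
  map_smul' _ _ := by ext; rfl
  norm_map' ξ := by
    rw [lp.norm_eq_tsum_rpow (by norm_num), lp.norm_eq_tsum_rpow (by norm_num)]
    congr 1
    exact e.tsum_eq (fun i => ‖ξ i‖ ^ (2 : ℝ≥0∞).toReal)

@[simp]
theorem permute_apply (e : ι ≃ ι) (ξ : Ell2 ι H) (i : ι) : permute e ξ i = ξ (e i) := rfl

end Operators

/-! ### Regular representations and the reduced crossed product of `(A, G, α)` -/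

section CrossedProduct

variable {A G H : Type*} [NonUnitalCStarAlgebra A] [Group G]
  [NormedAddCommGroup H] [InnerProductSpace ℂ H]

/-- The left translation operators `(u_t ξ)(s) = ξ (t⁻¹ s)` on `ℓ²(G, H)`. -/
def translation (H : Type*) [NormedAddCommGroup H] [InnerProductSpace ℂ H] (t : G) :
    Ell2 G H →L[ℂ] Ell2 G H :=
  (permute (Equiv.mulLeft t⁻¹)).toContinuousLinearMap

@[simp]
theorem translation_apply (t : G) (ξ : Ell2 G H) (s : G) :
    translation H t ξ s = ξ (t⁻¹ * s) := rfl

theorem translation_one : translation H (1 : G) = 1 := by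
  ext ξ s; simp

theorem translation_mul (s t : G) :
    translation H (s * t) = translation H s * translation H t := by
  ext ξ r; simp [mul_assoc]

variable [CompleteSpace H]

/-- The representation of `A` on `ℓ²(G, H)` given by `(a ξ)(s) = π (α_{s⁻¹} a) (ξ s)`. -/
def coeffRep (α : G →* (A ≃⋆ₐ[ℂ] A)) (π : A →⋆ₙₐ[ℂ] (H →L[ℂ] H)) (a : A) :
    Ell2 G H →L[ℂ] Ell2 G H :=
  diagonal (fun s => π (α s⁻¹ a)) (norm_nonneg a) fun s =>
    (NonUnitalStarAlgHom.norm_apply_le π _).trans (NonUnitalStarAlgHom.norm_apply_le (α s⁻¹) a)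

@[simp]
theorem coeffRep_apply (α : G →* (A ≃⋆ₐ[ℂ] A)) (π : A →⋆ₙₐ[ℂ] (H →L[ℂ] H)) (a : A)
    (ξ : Ell2 G H) (s : G) : coeffRep α π a ξ s = π (α s⁻¹ a) (ξ s) := rfl

variable (α : G →* (A ≃⋆ₐ[ℂ] A)) (π : A →⋆ₙₐ[ℂ] (H →L[ℂ] H))

theorem coeffRep_add (a b : A) : coeffRep α π (a + b) = coeffRep α π a + coeffRep α π b := by
  ext ξ s; simp

theorem coeffRep_zero : coeffRep α π 0 = 0 := by
  ext ξ s; simp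

theorem coeffRep_smul (c : ℂ) (a : A) : coeffRep α π (c • a) = c • coeffRep α π a := by
  ext ξ s; simp

theorem coeffRep_mul (a b : A) : coeffRep α π (a * b) = coeffRep α π a * coeffRep α π b := by
  ext ξ s; simp

theorem coeffRep_star (a : A) : coeffRep α π (star a) = star (coeffRep α π a) := by
  rw [ContinuousLinearMap.star_eq_adjoint, ContinuousLinearMap.eq_adjoint_iff]
  intro ξ η
  rw [lp.inner_eq_tsum, lp.inner_eq_tsum]
  congr 1
  ext s
  rw [coeffRep_apply, coeffRep_apply, map_star, map_star, ContinuousLinearMap.star_eq_adjoint,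
    ContinuousLinearMap.adjoint_inner_left]

theorem translation_star (t : G) : star (translation H t) = translation H t⁻¹ := by
  symm
  rw [ContinuousLinearMap.star_eq_adjoint, ContinuousLinearMap.eq_adjoint_iff]
  intro ξ η
  rw [lp.inner_eq_tsum, lp.inner_eq_tsum,
    ← (Equiv.mulLeft t).tsum_eq fun s => ⟪ξ s, translation H t η s⟫_ℂ]
  congr 1
  ext s
  simp

/-- Covariance: `u_t a = (α_t a) u_t`. -/
theorem translation_mul_coeffRep (t : G) (a : A) :
    translation H t * coeffRep α π a = coeffRep α π (α t a) * translation H t := by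
  ext ξ s
  have h : α (t⁻¹ * s)⁻¹ a = α s⁻¹ (α t a) := by
    rw [mul_inv_rev, inv_inv, map_mul]; rfl
  change π (α (t⁻¹ * s)⁻¹ a) (ξ (t⁻¹ * s)) = π (α s⁻¹ (α t a)) (ξ (t⁻¹ * s))
  rw [h]

/-- The operator on `ℓ²(G, H)` given by the finite sum `∑ t, a_t u_t`. -/
def finiteSum (f : G →₀ A) : Ell2 G H →L[ℂ] Ell2 G H :=
  f.sum fun t a => coeffRep α π a * translation H t

theorem finiteSum_single (t : G) (a : A) :
    finiteSum α π (Finsupp.single t a) = coeffRep α π a * translation H t := by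
  rw [finiteSum, Finsupp.sum_single_index]
  rw [coeffRep_zero, zero_mul]

theorem finiteSum_add (f g : G →₀ A) :
    finiteSum α π (f + g) = finiteSum α π f + finiteSum α π g := by
  classical
  exact Finsupp.sum_add_index' (fun t => by rw [coeffRep_zero, zero_mul])
    (fun t a b => by rw [coeffRep_add, add_mul])

theorem coeffRep_mul_translation_mul (s t : G) (a b : A) :
    (coeffRep α π a * translation H s) * (coeffRep α π b * translation H t) =
      coeffRep α π (a * α s b) * translation H (s * t) := by
  rw [mul_assoc, ← mul_assoc (translation H s), translation_mul_coeffRep, coeffRep_mul,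
    translation_mul]
  simp only [mul_assoc]

theorem coeffRep_mul_translation_star (t : G) (a : A) :
    star (coeffRep α π a * translation H t) =
      coeffRep α π (α t⁻¹ (star a)) * translation H t⁻¹ := by
  rw [star_mul, translation_star, ← coeffRep_star, translation_mul_coeffRep]

theorem finiteSum_induction {P : (Ell2 G H →L[ℂ] Ell2 G H) → Prop} (h0 : P 0)
    (hadd : ∀ S T, P S → P T → P (S + T))
    (hsingle : ∀ t a, P (coeffRep α π a * translation H t)) (f : G →₀ A) :
    P (finiteSum α π f) := by
  induction f using Finsupp.induction_linear with
  | zero => simpa [finiteSum] using h0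
  | add f g hf hg => rw [finiteSum_add]; exact hadd _ _ hf hg
  | single t a => rw [finiteSum_single]; exact hsingle t a

/-- `C_c(G, A)`: the `*`-algebra of all finite sums `∑ t, a_t u_t` with `a_t ∈ A`, represented on
`ℓ²(G, H)` by the regular representation induced by `π`. -/
def finiteSums : NonUnitalStarSubalgebra ℂ (Ell2 G H →L[ℂ] Ell2 G H) where
  carrier := Set.range (finiteSum α π)
  add_mem' := by
    rintro _ _ ⟨f, rfl⟩ ⟨g, rfl⟩
    exact ⟨f + g, finiteSum_add α π f g⟩
  zero_mem' := ⟨0, by simp [finiteSum]⟩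
  smul_mem' := by
    rintro c _ ⟨f, rfl⟩
    refine finiteSum_induction α π (P := fun S => c • S ∈ Set.range (finiteSum α π)) ?_ ?_ ?_ f
    · exact ⟨0, by simp [finiteSum]⟩
    · rintro S T ⟨g, hg⟩ ⟨h, hh⟩
      exact ⟨g + h, by rw [finiteSum_add, hg, hh, smul_add]⟩
    · intro t a
      exact ⟨Finsupp.single t (c • a), by rw [finiteSum_single, coeffRep_smul, smul_mul_assoc]⟩
  mul_mem' := by
    rintro _ _ ⟨f, rfl⟩ ⟨g, rfl⟩
    refine finiteSum_induction α π
      (P := fun S => S * finiteSum α π g ∈ Set.range (finiteSum α π)) ?_ ?_ ?_ f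
    · exact ⟨0, by simp [finiteSum]⟩
    · rintro S T ⟨p, hp⟩ ⟨q, hq⟩
      exact ⟨p + q, by rw [finiteSum_add, hp, hq, add_mul]⟩
    · intro s a
      refine finiteSum_induction α π (P := fun T =>
        (coeffRep α π a * translation H s) * T ∈ Set.range (finiteSum α π)) ?_ ?_ ?_ g
      · exact ⟨0, by simp [finiteSum]⟩
      · rintro S T ⟨p, hp⟩ ⟨q, hq⟩
        exact ⟨p + q, by rw [finiteSum_add, hp, hq, mul_add]⟩
      · intro t b
        exact ⟨Finsupp.single (s * t) (a * α s b), by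
          rw [finiteSum_single, coeffRep_mul_translation_mul]⟩
  star_mem' := by
    rintro _ ⟨f, rfl⟩
    refine finiteSum_induction α π (P := fun S => star S ∈ Set.range (finiteSum α π)) ?_ ?_ ?_ f
    · exact ⟨0, by simp [finiteSum]⟩
    · rintro S T ⟨g, hg⟩ ⟨h, hh⟩
      exact ⟨g + h, by rw [finiteSum_add, hg, hh, star_add]⟩
    · intro t a
      exact ⟨Finsupp.single t⁻¹ (α t⁻¹ (star a)), by
        rw [finiteSum_single, coeffRep_mul_translation_star]⟩

/-- The reduced crossed product `A ⋊_r G`: the norm closure of `C_c(G, A)` in the regular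
representation on `ℓ²(G, H)` induced by a representation `π` of `A` on `H`. For faithful `π`
(the only case in which it deserves the name) it does not depend on `π`. -/
def ReducedCrossedProduct : Type _ := (finiteSums α π).topologicalClosure

instance : NonUnitalCStarAlgebra (ReducedCrossedProduct α π) :=
  NonUnitalStarSubalgebra.nonUnitalCStarAlgebra (finiteSums α π).topologicalClosure
    (h_closed := (finiteSums α π).isClosed_topologicalClosure)

/-- The usual order of a C⋆-algebra. -/
instance : PartialOrder (ReducedCrossedProduct α π) := CStarAlgebra.spectralOrder _

instance : StarOrderedRing (ReducedCrossedProduct α π) := CStarAlgebra.spectralOrderedRing _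

/-- The finite sum `∑ t, a_t u_t` as an element of the reduced crossed product. -/
def ofFinsupp (f : G →₀ A) : ReducedCrossedProduct α π :=
  ⟨finiteSum α π f, (finiteSums α π).le_topologicalClosure ⟨f, rfl⟩⟩

/-- The inclusion of `A` into the reduced crossed product, `a ↦ a u_e`. -/
def incl (a : A) : ReducedCrossedProduct α π := ofFinsupp α π (Finsupp.single 1 a)

end CrossedProduct

/-! ### Cuntz comparison and proper infiniteness -/

section Cuntz

variable {A : Type*} [NonUnitalCStarAlgebra A]

/-- Cuntz comparison `a ≾ b` of positive matrices `a ∈ M_n(A)`, `b ∈ M_m(A)`: there are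
`r_k ∈ M_{m,n}(A)` with `r_k* b r_k → a`. -/
def CuntzLE {m n : ℕ} (a : CStarMatrix (Fin n) (Fin n) A) (b : CStarMatrix (Fin m) (Fin m) A) :
    Prop :=
  ∃ r : ℕ → CStarMatrix (Fin m) (Fin n) A,
    Tendsto (fun k => (r k).conjTranspose * b * r k) atTop (𝓝 a)

/-- The matrix `a ⊕ ⋯ ⊕ a ∈ M_n(A)`. -/
def diag (n : ℕ) (a : A) : CStarMatrix (Fin n) (Fin n) A :=
  CStarMatrix.ofMatrix (Matrix.diagonal fun _ => a)

/-- A positive element `a` is properly infinite if `a ≠ 0` and `a ⊕ a ≾ a`. -/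
def IsProperlyInfinite [PartialOrder A] [StarOrderedRing A] (a : A) : Prop :=
  0 ≤ a ∧ a ≠ 0 ∧ CuntzLE (diag 2 a) (diag 1 a)

end Cuntz

/-! ### Group actions on spaces -/

section Actions

/-- A non-empty set `U` is `(G, E)`-paradoxical if there are non-empty `V₁, …, V_{n+m} ∈ E` and
`t₁, …, t_{n+m} ∈ G` with `V₁ ∪ ⋯ ∪ V_n = V_{n+1} ∪ ⋯ ∪ V_{n+m} = U` and such that the sets
`t_k V_k` are pairwise disjoint subsets of `U`. -/
def IsParadoxical (G : Type*) {X : Type*} [Group G] [MulAction G X] (E : Set (Set X))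
    (U : Set X) : Prop :=
  U.Nonempty ∧ ∃ (n m : ℕ) (V : Fin (n + m) → Set X) (t : Fin (n + m) → G),
    (∀ k, V k ∈ E ∧ (V k).Nonempty) ∧
    (⋃ i : Fin n, V (Fin.castAdd m i)) = U ∧
    (⋃ j : Fin m, V (Fin.natAdd n j)) = U ∧
    (∀ k, t k • V k ⊆ U) ∧
    Pairwise fun k l => Disjoint (t k • V k) (t l • V l)

variable {X : Type*} [TopologicalSpace X]

/-- The characteristic function `1_U` of a compact open set, as an element of `C₀(X)`. -/
def charFun [T2Space X] (U : Set X) (hc : IsCompact U) (ho : IsOpen U) : C₀(X, ℂ) where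
  toFun := U.indicator 1
  continuous_toFun := continuous_one.indicator fun x hx => by
    rw [IsClopen.frontier_eq ⟨hc.isClosed, ho⟩] at hx
    exact hx.elim
  zero_at_infty' := by
    refine tendsto_const_nhds.congr' ?_
    filter_upwards [hc.compl_mem_cocompact] with x hx
    exact (Set.indicator_of_notMem hx _).symm

variable (G : Type*) [Group G] [MulAction G X] [ContinuousConstSMul G X]

variable (X) in
/-- The action of `G` on `C₀(X)` induced by an action on `X`: `(t f)(x) = f (t⁻¹ x)`. -/
def actionC0 : G →* (C₀(X, ℂ) ≃⋆ₐ[ℂ] C₀(X, ℂ)) where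
  toFun t :=
    { toFun := fun f => f.comp (Homeomorph.smul t⁻¹ : X ≃ₜ X).toCocompactMap
      invFun := fun f => f.comp (Homeomorph.smul t : X ≃ₜ X).toCocompactMap
      left_inv := fun f => by ext x; simp
      right_inv := fun f => by ext x; simp
      map_add' := fun f g => by ext x; simp
      map_mul' := fun f g => by ext x; simp
      map_smul' := fun c f => by ext x; simp
      map_star' := fun f => by ext x; simp }
  map_one' := by ext f x; simp
  map_mul' s t := by ext f x; simp [mul_smul]

variable {G} {H : Type*} [NormedAddCommGroup H] [InnerProductSpace ℂ H] [CompleteSpace H]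

/-- The projection `1_U` of a compact open set, as an element of `C₀(X) ⋊_r G`. -/
def charProj [T2Space X] (π : C₀(X, ℂ) →⋆ₙₐ[ℂ] (H →L[ℂ] H)) (U : Set X) (hc : IsCompact U)
    (ho : IsOpen U) : ReducedCrossedProduct (actionC0 X G) π :=
  incl (actionC0 X G) π (charFun U hc ho)

/-- `C_c(G, C₀(X)⁺)`: the finite sums `∑ t, a_t u_t` in `C₀(X) ⋊_r G` with all `a_t ≥ 0`. -/
def posFiniteSums (π : C₀(X, ℂ) →⋆ₙₐ[ℂ] (H →L[ℂ] H)) :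
    Set (ReducedCrossedProduct (actionC0 X G) π) :=
  {x | ∃ f : G →₀ C₀(X, ℂ), (∀ t ξ, 0 ≤ f t ξ) ∧ x = ofFinsupp (actionC0 X G) π f}

end Actions

/-! ### A faithful representation of `C₀(X)` -/

section Faithful

variable {X : Type*} [TopologicalSpace X]

theorem norm_mulLeft_le (f : C₀(X, ℂ)) (x : X) :
    ‖ContinuousLinearMap.mul ℂ ℂ (f x)‖ ≤ ‖f‖ := by
  rw [ContinuousLinearMap.opNorm_mul_apply]
  exact f.toBCF.norm_coe_le_norm x

/-- The representation of `C₀(X)` on `ℓ²(X)` by multiplication operators. -/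
def multiplicationRep (X : Type*) [TopologicalSpace X] :
    C₀(X, ℂ) →⋆ₙₐ[ℂ] (Ell2 X ℂ →L[ℂ] Ell2 X ℂ) where
  toFun f := diagonal (fun x => ContinuousLinearMap.mul ℂ ℂ (f x)) (norm_nonneg f)
    (norm_mulLeft_le f)
  map_smul' c f := by ext ξ x; simp [mul_assoc]
  map_zero' := by ext ξ x; simp
  map_add' f g := by ext ξ x; simp
  map_mul' f g := by ext ξ x; simp [mul_assoc]
  map_star' f := by
    rw [ContinuousLinearMap.star_eq_adjoint, ContinuousLinearMap.eq_adjoint_iff]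
    intro ξ η
    rw [lp.inner_eq_tsum, lp.inner_eq_tsum]
    congr 1
    ext x
    simp
    ring

/-- `C₀(X)` has a faithful representation, so that its reduced crossed products exist. -/
theorem multiplicationRep_injective (X : Type*) [TopologicalSpace X] :
    Function.Injective (multiplicationRep X) := by
  classical
  intro f g h
  ext x
  have := congrArg (fun T : Ell2 X ℂ →L[ℂ] Ell2 X ℂ => T (lp.single 2 x 1) x) h
  simpa [multiplicationRep] using this

end Faithful

end CrossedProduct

end

/-!
For `x = ∑ a_t u_t` and `y = ∑ b_t u_t` the coefficient of `x⋆y` at `r` is the sum of the functions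
`ξ ↦ conj (a_s (s ξ)) b_t (s ξ)` over the pairs with `s⁻¹ t = r`, and for faithful `π` an element
determines its coefficients (`ofFinsupp_injective`).

Suppose that all coefficients are positive, that `x⋆x = y⋆y = 1_U` and that `xx⋆ + yy⋆ ≤ 1_U`. Then
`x` and `y` are partial isometries with orthogonal ranges below `1_U`
(`mul_eq_self_and_star_mul_eq_zero`), so that `x⋆y = 0`. Since nothing can cancel among positive
functions, the cozero sets of all the `a_s` and `b_t` are pairwise disjoint
(`mul_eq_zero_of_star_mul_eq_incl`). They lie in `U` because `1_U x = x` and `1_U y = y`, and their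
translates `{ξ | a_s (s ξ) ≠ 0}`, as well as `{ξ | b_t (t ξ) ≠ 0}`, cover `U` by the coefficient of
`x⋆x` and `y⋆y` at the unit. This is a paradoxical decomposition (`isParadoxical_of_isometries`).

Conversely, let `V_k`, `t_k` be a paradoxical decomposition and choose a partition of unity `(h_k)`
on `U` subordinate to the first cover. Then `x = ∑ u_{t_k} h_k^{1/2}` has positive coefficients
supported in the disjoint sets `t_k V_k`, so that `x⋆x = ∑ h_k = 1_U`. The second cover gives `y`
in the same way, and `x⋆y = 0` (`exists_isometries_of_isParadoxical`). The row `(x, y)` then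
witnesses `1_U ⊕ 1_U ≾ 1_U` (`isProperlyInfinite_of_star_mul`).
-/

namespace CrossedProduct

/-! ### Partial isometries in a C⋆-algebra -/

section PartialIsometries

variable {A : Type*} [NonUnitalCStarAlgebra A]

theorem mul_eq_self_of_star_mul_self_eq {p x : A} (hp : p * p = p) (hx : star x * x = p) :
    x * p = x := by
  have hps : star p = p := by rw [← hx]; simp
  have h : star (x * p - x) * (x * p - x) = 0 := by
    have h1 : star x * (x * p) = p := by rw [← mul_assoc, hx, hp]
    simp only [star_sub, star_mul, hps, sub_mul, mul_sub, mul_assoc, hx, h1, hp]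
    simp
  exact sub_eq_zero.1 ((CStarRing.star_mul_self_eq_zero_iff _).1 h)

variable [PartialOrder A] [StarOrderedRing A]

theorem eq_zero_of_mul_star_self_nonpos {z : A} (h : z * star z ≤ 0) : z = 0 :=
  (CStarRing.mul_star_self_eq_zero_iff z).1 (le_antisymm h (mul_star_self_nonneg z))

theorem mul_eq_self_of_mul_star_self_le {p x : A} (hp : p * p = p) (hps : star p = p)
    (h : x * star x ≤ p) : p * x = x := by
  -- In the unitization, conjugating `x x⋆ ≤ p` by `1 - p` gives `z z⋆ ≤ 0` for `z = (1 - p) x`.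
  have h' : ((x * star x : A) : Unitization ℂ A) ≤ p :=
    (Unitization.inr_le_iff _ _ (IsSelfAdjoint.mul_star_self x) hps).2 h
  have hc := star_right_conjugate_le_conjugate h' (1 - (p : Unitization ℂ A))
  have hpu : (p : Unitization ℂ A) * p = p := by rw [← Unitization.inr_mul, hp]
  have hz : (1 - (p : Unitization ℂ A)) * p * star (1 - (p : Unitization ℂ A)) = 0 := by
    rw [sub_mul, one_mul, hpu, sub_self, zero_mul]
  rw [hz] at hc
  have h0 : (1 - (p : Unitization ℂ A)) * x = 0 := by
    apply eq_zero_of_mul_star_self_nonpos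
    rw [star_mul]
    simpa [mul_assoc] using hc
  rw [sub_mul, one_mul, sub_eq_zero] at h0
  apply Unitization.inr_injective (R := ℂ)
  simpa using h0.symm

/-- If `x⋆x = p` is a projection and `xx⋆ + yy⋆ ≤ p`, then `x` and `y` have orthogonal ranges
below `p`. -/
theorem mul_eq_self_and_star_mul_eq_zero {p x y : A} (hp : p * p = p) (hx : star x * x = p)
    (h : x * star x + y * star y ≤ p) : p * x = x ∧ p * y = y ∧ star x * y = 0 := by
  have hps : star p = p := by rw [← hx]; simp
  have hpx : p * x = x := mul_eq_self_of_mul_star_self_le hp hps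
    ((le_add_of_nonneg_right (mul_star_self_nonneg y)).trans h)
  have hpy : p * y = y := mul_eq_self_of_mul_star_self_le hp hps
    ((le_add_of_nonneg_left (mul_star_self_nonneg x)).trans h)
  refine ⟨hpx, hpy, eq_zero_of_mul_star_self_nonpos ?_⟩
  -- Conjugation by `x⋆` turns the hypothesis into `p + (x⋆y)(x⋆y)⋆ ≤ p`.
  have hc := star_left_conjugate_le_conjugate h x
  have e1 : star x * (x * star x + y * star y) * x
      = p + star x * y * star (star x * y) := by
    rw [star_mul, star_star, mul_add, add_mul, ← mul_assoc, hx, mul_assoc p, hx, hp]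
    simp only [mul_assoc]
  have e2 : star x * p * x = p := by rw [mul_assoc, hpx, hx]
  rw [e1, e2] at hc
  simpa using hc

/-- Conversely, if `x` and `y` have initial projection `p` and orthogonal ranges below `p`, then
`p - (xx⋆ + yy⋆)` is a projection. -/
theorem mul_star_add_mul_star_le {p x y : A} (hp : p * p = p) (hx : star x * x = p)
    (hy : star y * y = p) (hpx : p * x = x) (hpy : p * y = y) (hxy : star x * y = 0) :
    x * star x + y * star y ≤ p := by
  have hps : star p = p := by rw [← hx]; simp
  have hxp := mul_eq_self_of_star_mul_self_eq hp hx
  have hyp := mul_eq_self_of_star_mul_self_eq hp hy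
  have hyx : star y * x = 0 := by simpa using congrArg star hxy
  have hxsp : star x * p = star x := by rw [← hps, ← star_mul, hpx]
  have hysp : star y * p = star y := by rw [← hps, ← star_mul, hpy]
  have hd : p - (x * star x + y * star y) =
      star (p - (x * star x + y * star y)) * (p - (x * star x + y * star y)) := by
    have e1 : p * (x * star x) = x * star x := by rw [← mul_assoc, hpx]
    have e2 : p * (y * star y) = y * star y := by rw [← mul_assoc, hpy]
    have e3 : star x * (x * star x) = star x := by
      rw [← mul_assoc, hx, ← hps, ← star_mul, hxp]
    have e4 : star y * (y * star y) = star y := by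
      rw [← mul_assoc, hy, ← hps, ← star_mul, hyp]
    have e5 : star x * (y * star y) = 0 := by rw [← mul_assoc, hxy, zero_mul]
    have e6 : star y * (x * star x) = 0 := by rw [← mul_assoc, hyx, zero_mul]
    simp only [star_sub, star_add, star_mul, star_star, hps, sub_mul, mul_sub, add_mul, mul_add,
      mul_assoc, hp, hxsp, hysp, e1, e2, e3, e4, e5, e6, mul_zero]
    abel
  rw [← sub_nonneg, hd]
  exact star_mul_self_nonneg _

/-- A projection `p` with two orthogonal subprojections equivalent to `p` is properly infinite:
the row `(x, y)` implements `p ⊕ p ≾ p` exactly. -/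
theorem isProperlyInfinite_of_star_mul {p x y : A} (h0 : p ≠ 0) (hx : star x * x = p)
    (hy : star y * y = p) (hpx : p * x = x) (hpy : p * y = y) (hxy : star x * y = 0) :
    IsProperlyInfinite p := by
  have hyx : star y * x = 0 := by simpa using congrArg star hxy
  refine ⟨hx ▸ star_mul_self_nonneg x, h0, fun _ => CStarMatrix.ofMatrix !![x, y], ?_⟩
  refine tendsto_const_nhds.congr fun _ => ?_
  ext i j
  fin_cases i <;> fin_cases j <;>
    simp [diag, CStarMatrix.mul_apply, CStarMatrix.conjTranspose_apply, mul_assoc, hpx, hpy, hx,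
      hy, hxy, hyx]

end PartialIsometries

/-! ### Coefficients of finite sums -/

section Coefficients

variable {A G H : Type*} [NonUnitalCStarAlgebra A] [Group G]
  [NormedAddCommGroup H] [InnerProductSpace ℂ H] [CompleteSpace H]
  (α : G →* (A ≃⋆ₐ[ℂ] A)) (π : A →⋆ₙₐ[ℂ] (H →L[ℂ] H))

theorem finiteSum_apply_single [DecidableEq G] (f : G →₀ A) (h : H) (s : G) :
    finiteSum α π f (lp.single 2 1 h) s = π (α s⁻¹ (f s)) h := by
  induction f using Finsupp.induction_linear with
  | zero => simp [finiteSum]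
  | add f g hf hg => simp [finiteSum_add, hf, hg]
  | single t a =>
    rw [finiteSum_single]
    change π (α s⁻¹ a) ((lp.single 2 1 h : Ell2 G H) (t⁻¹ * s)) = _
    by_cases hst : t = s
    · subst hst; simp
    · have : t⁻¹ * s ≠ 1 := fun h => hst (inv_mul_eq_one.1 h)
      simp [this, Finsupp.single_eq_of_ne (Ne.symm hst)]

variable {π} in
/-- For faithful `π` a finite sum determines its coefficients: they can be read off from its
values on the vectors supported at the unit. -/
theorem ofFinsupp_injective (hπ : Function.Injective π) :
    Function.Injective (ofFinsupp α π) := by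
  classical
  intro f g h
  have h' : finiteSum α π f = finiteSum α π g := congrArg Subtype.val h
  ext s
  apply (α s⁻¹).injective
  apply hπ
  ext v
  change π (α s⁻¹ (f s)) v = π (α s⁻¹ (g s)) v
  rw [← finiteSum_apply_single, ← finiteSum_apply_single, h']

/-- `f ↦ ∑ t, f t u_t` as an additive homomorphism. -/
noncomputable def ofFinsuppHom : (G →₀ A) →+ ReducedCrossedProduct α π where
  toFun := ofFinsupp α π
  map_zero' := Subtype.ext (by simp only [ofFinsupp, finiteSum, Finsupp.sum_zero_index]; rfl)
  map_add' f g := Subtype.ext (finiteSum_add α π f g)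

theorem ofFinsupp_sum {ι : Type*} (s : Finset ι) (f : ι → G →₀ A) :
    ofFinsupp α π (∑ i ∈ s, f i) = ∑ i ∈ s, ofFinsupp α π (f i) :=
  map_sum (ofFinsuppHom α π) f s

theorem ofFinsupp_zero : ofFinsupp α π 0 = 0 := map_zero (ofFinsuppHom α π)

theorem ofFinsupp_eq_sum_single (f : G →₀ A) :
    ofFinsupp α π f = ∑ t ∈ f.support, ofFinsupp α π (Finsupp.single t (f t)) := by
  conv_lhs => rw [← Finsupp.sum_single f, Finsupp.sum, ofFinsupp_sum]

theorem ofFinsupp_single_mul_single (s t : G) (a b : A) :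
    ofFinsupp α π (Finsupp.single s a) * ofFinsupp α π (Finsupp.single t b) =
      ofFinsupp α π (Finsupp.single (s * t) (a * α s b)) := by
  apply Subtype.ext
  change finiteSum α π _ * finiteSum α π _ = finiteSum α π _
  simp only [finiteSum_single, coeffRep_mul_translation_mul]

theorem star_ofFinsupp_single (t : G) (a : A) :
    star (ofFinsupp α π (Finsupp.single t a)) =
      ofFinsupp α π (Finsupp.single t⁻¹ (α t⁻¹ (star a))) := by
  apply Subtype.ext
  change star (finiteSum α π _) = finiteSum α π _
  simp only [finiteSum_single, coeffRep_mul_translation_star]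

theorem star_ofFinsupp_single_mul_single (s t : G) (a b : A) :
    star (ofFinsupp α π (Finsupp.single s a)) * ofFinsupp α π (Finsupp.single t b) =
      ofFinsupp α π (Finsupp.single (s⁻¹ * t) (α s⁻¹ (star a * b))) := by
  rw [star_ofFinsupp_single, ofFinsupp_single_mul_single, map_mul]

theorem star_ofFinsupp_mul_ofFinsupp (f g : G →₀ A) :
    star (ofFinsupp α π f) * ofFinsupp α π g =
      ofFinsupp α π (∑ s ∈ f.support, ∑ t ∈ g.support,
        Finsupp.single (s⁻¹ * t) (α s⁻¹ (star (f s) * g t))) := by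
  rw [ofFinsupp_eq_sum_single α π f, ofFinsupp_eq_sum_single α π g, star_sum, Finset.sum_mul_sum,
    ofFinsupp_sum]
  simp only [ofFinsupp_sum, star_ofFinsupp_single_mul_single]

theorem incl_mul_ofFinsupp (a : A) (f : G →₀ A) :
    incl α π a * ofFinsupp α π f =
      ofFinsupp α π (∑ t ∈ f.support, Finsupp.single t (a * f t)) := by
  rw [incl, ofFinsupp_eq_sum_single α π f, Finset.mul_sum, ofFinsupp_sum]
  simp only [ofFinsupp_single_mul_single, one_mul, map_one, StarAlgEquiv.one_apply]

theorem incl_mul_incl (a b : A) : incl α π a * incl α π b = incl α π (a * b) := by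
  simp only [incl, ofFinsupp_single_mul_single, one_mul, map_one, StarAlgEquiv.one_apply]

end Coefficients

/-! ### Evaluation of functions vanishing at infinity -/

section Functions

variable {X : Type*} [TopologicalSpace X]

/-- Evaluation at a point as an additive homomorphism on `C₀(X)`. -/
noncomputable def evalHom (ξ : X) : C₀(X, ℂ) →+ ℂ where
  toFun f := f ξ
  map_zero' := rfl
  map_add' _ _ := rfl

theorem sum_apply {ι : Type*} (s : Finset ι) (f : ι → C₀(X, ℂ)) (ξ : X) :
    (∑ i ∈ s, f i) ξ = ∑ i ∈ s, f i ξ :=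
  map_sum (evalHom ξ) f s

theorem actionC0_apply {G : Type*} [Group G] [MulAction G X] [ContinuousConstSMul G X] (t : G)
    (f : C₀(X, ℂ)) (ξ : X) : actionC0 X G t f ξ = f (t⁻¹ • ξ) := rfl

/-- The set `t • {ξ | a (t ξ) ≠ 0}` is the cozero set of `a`. -/
theorem smul_setOf_apply_smul_ne_zero {G : Type*} [Group G] [MulAction G X] (t : G)
    (a : C₀(X, ℂ)) :
    t • {ξ | a (t • ξ) ≠ 0} = {η | a η ≠ 0} := by
  ext η
  simp [Set.mem_smul_set_iff_inv_smul_mem]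

variable [T2Space X] {U : Set X} (hc : IsCompact U) (ho : IsOpen U)

theorem charFun_apply [DecidablePred (· ∈ U)] (ξ : X) :
    charFun U hc ho ξ = if ξ ∈ U then 1 else 0 := by
  classical
  change U.indicator 1 ξ = _
  simp [Set.indicator_apply]

theorem charFun_mul_eq_self_iff (f : C₀(X, ℂ)) :
    charFun U hc ho * f = f ↔ ∀ ξ, f ξ ≠ 0 → ξ ∈ U := by
  classical
  constructor
  · intro h ξ hξ
    by_contra hU
    have := DFunLike.congr_fun h ξ
    simp [charFun_apply, hU] at this
    exact hξ this.symm
  · intro h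
    ext ξ
    by_cases hU : ξ ∈ U
    · simp [charFun_apply, hU]
    · have : f ξ = 0 := by_contra fun h0 => hU (h ξ h0)
      simp [this]

end Functions

/-! ### From isometries with positive coefficients to paradoxical decompositions -/

section Decomposition

variable {X G H : Type*} [TopologicalSpace X] [Group G] [MulAction G X] [ContinuousConstSMul G X]
  [NormedAddCommGroup H] [InnerProductSpace ℂ H] [CompleteSpace H]
  {π : C₀(X, ℂ) →⋆ₙₐ[ℂ] (H →L[ℂ] H)}

/-- Comparison of the coefficients in `x⋆y = c u_e`. -/
theorem sum_star_mul_eq_of_star_mul_eq_incl [DecidableEq G] (hπ : Function.Injective π)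
    {f g : G →₀ C₀(X, ℂ)} {c : C₀(X, ℂ)}
    (h : star (ofFinsupp (actionC0 X G) π f) * ofFinsupp (actionC0 X G) π g =
      incl (actionC0 X G) π c) (r : G) (ξ : X) :
    (∑ s ∈ f.support, ∑ t ∈ g.support,
      if s⁻¹ * t = r then star (f s (s • ξ)) * g t (s • ξ) else 0) = if 1 = r then c ξ else 0 := by
  rw [star_ofFinsupp_mul_ofFinsupp, incl] at h
  have h' := DFunLike.congr_fun (DFunLike.congr_fun (ofFinsupp_injective _ hπ h) r) ξ
  simp only [Finsupp.finsetSum_apply, sum_apply, Finsupp.single_apply] at h'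
  convert h' using 1
  · refine Finset.sum_congr rfl fun s _ => Finset.sum_congr rfl fun t _ => ?_
    split_ifs
    · rw [actionC0_apply, inv_inv]; rfl
    · rfl
  · split_ifs <;> rfl

/-- As the coefficients are positive, nothing cancels in a vanishing coefficient of `x⋆y`. -/
theorem mul_eq_zero_of_star_mul_eq_incl (hπ : Function.Injective π)
    {f g : G →₀ C₀(X, ℂ)} (hf : ∀ t ξ, 0 ≤ f t ξ) (hg : ∀ t ξ, 0 ≤ g t ξ) {c : C₀(X, ℂ)}
    (h : star (ofFinsupp (actionC0 X G) π f) * ofFinsupp (actionC0 X G) π g =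
      incl (actionC0 X G) π c) {s t : G} (hst : s ≠ t ∨ c = 0) (η : X) : f s η * g t η = 0 := by
  classical
  by_cases hs : s ∈ f.support
  swap
  · simp [Finsupp.notMem_support_iff.1 hs]
  by_cases ht : t ∈ g.support
  swap
  · simp [Finsupp.notMem_support_iff.1 ht]
  have key := sum_star_mul_eq_of_star_mul_eq_incl hπ h (s⁻¹ * t) (s⁻¹ • η)
  have h0 : (if 1 = s⁻¹ * t then c (s⁻¹ • η) else 0) = 0 := by
    split_ifs with h1
    · rcases hst with hst | rfl
      · exact absurd (inv_mul_eq_one.1 h1.symm) hst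
      · rfl
    · rfl
  have hnn : ∀ a b : G, 0 ≤ if a⁻¹ * b = s⁻¹ * t then
      star (f a (a • s⁻¹ • η)) * g b (a • s⁻¹ • η) else 0 := by
    intro a b
    split_ifs
    · exact mul_nonneg (star_nonneg_iff.2 (hf _ _)) (hg _ _)
    · exact le_rfl
  rw [h0, Finset.sum_eq_zero_iff_of_nonneg fun a _ => Finset.sum_nonneg fun b _ => hnn a b] at key
  have := (Finset.sum_eq_zero_iff_of_nonneg fun b _ => hnn s b).1 (key s hs) t ht
  simpa [(star_nonneg_iff.2 (hf s η)).star_eq] using this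

/-- The coefficient of `x⋆x` at the unit is `ξ ↦ ∑ s, |f s (s ξ)|²`, which vanishes exactly off the
union on the left. -/
theorem iUnion_ne_zero_of_star_mul_self_eq_charProj [T2Space X] (hπ : Function.Injective π)
    {U : Set X} {hc : IsCompact U} {ho : IsOpen U} {f : G →₀ C₀(X, ℂ)}
    (h : star (ofFinsupp (actionC0 X G) π f) * ofFinsupp (actionC0 X G) π f =
      charProj π U hc ho) : ⋃ s : f.support, {ξ | f s ((s : G) • ξ) ≠ 0} = U := by
  classical
  ext ξ
  have key := sum_star_mul_eq_of_star_mul_eq_incl hπ h 1 ξ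
  have key' : ∑ s ∈ f.support, star (f s (s • ξ)) * f s (s • ξ) = if ξ ∈ U then 1 else 0 := by
    rw [← charFun_apply hc ho, ← key.trans (if_pos rfl)]
    refine Finset.sum_congr rfl fun s hs => ?_
    simp_rw [inv_mul_eq_one]
    rw [Finset.sum_ite_eq, if_pos hs]
  simp only [Set.mem_iUnion, Set.mem_ofPred_eq]
  by_cases hξ : ξ ∈ U
  · simp only [hξ, iff_true]
    by_contra hcon
    push Not at hcon
    rw [Finset.sum_eq_zero fun s hs => by rw [hcon ⟨s, hs⟩, mul_zero], if_pos hξ] at key'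
    exact zero_ne_one key'
  · simp only [hξ, iff_false, not_exists, not_not]
    rw [if_neg hξ, Finset.sum_eq_zero_iff_of_nonneg fun s _ => star_mul_self_nonneg _] at key'
    exact fun s => (CStarRing.star_mul_self_eq_zero_iff _).1 (key' s s.2)

end Decomposition

section Decomposition

variable {X G H : Type*} [TopologicalSpace X] [T2Space X] [Group G] [MulAction G X]
  [ContinuousConstSMul G X] [NormedAddCommGroup H] [InnerProductSpace ℂ H] [CompleteSpace H]
  {π : C₀(X, ℂ) →⋆ₙₐ[ℂ] (H →L[ℂ] H)} {U : Set X} {hc : IsCompact U} {ho : IsOpen U}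

theorem charProj_mul_self : charProj π U hc ho * charProj π U hc ho =
    (charProj π U hc ho : ReducedCrossedProduct (actionC0 X G) π) := by
  classical
  rw [charProj, incl_mul_incl, (charFun_mul_eq_self_iff hc ho _).2]
  intro ξ hξ
  by_contra hU
  exact hξ (by rw [charFun_apply, if_neg hU])

theorem charProj_ne_zero (hπ : Function.Injective π) (hU : U.Nonempty) :
    (charProj π U hc ho : ReducedCrossedProduct (actionC0 X G) π) ≠ 0 := by
  classical
  intro h
  rw [charProj, incl, ← ofFinsupp_zero] at h
  have h1 : charFun U hc ho = 0 := by
    simpa using ofFinsupp_injective (actionC0 X G) hπ h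
  obtain ⟨ξ, hξ⟩ := hU
  have h2 := DFunLike.congr_fun h1 ξ
  simp [charFun_apply, hξ] at h2

theorem mem_of_charProj_mul_eq_self (hπ : Function.Injective π) {f : G →₀ C₀(X, ℂ)}
    (h : charProj π U hc ho * ofFinsupp (actionC0 X G) π f = ofFinsupp (actionC0 X G) π f)
    {t : G} {ξ : X} (ht : f t ξ ≠ 0) : ξ ∈ U := by
  classical
  rw [charProj, incl_mul_ofFinsupp] at h
  have h1 := DFunLike.congr_fun (ofFinsupp_injective _ hπ h) t
  have hs : t ∈ f.support := Finsupp.mem_support_iff.2 fun h0 => ht (by rw [h0]; rfl)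
  simp only [Finsupp.finsetSum_apply, Finsupp.single_apply, Finset.sum_ite_eq', hs, if_true] at h1
  exact (charFun_mul_eq_self_iff hc ho (f t)).1 h1 ξ ht

/-- Given isometries `x = ∑ a_s u_s` and `y = ∑ b_s u_s` over `1_U` with positive coefficients and
orthogonal ranges, the sets `{ξ | a_s (s ξ) ≠ 0}` and `{ξ | b_s (s ξ) ≠ 0}` form a paradoxical
decomposition of `U`. -/
theorem isParadoxical_of_isometries (hπ : Function.Injective π) (hU : U.Nonempty)
    {f g : G →₀ C₀(X, ℂ)} (hf : ∀ t ξ, 0 ≤ f t ξ) (hg : ∀ t ξ, 0 ≤ g t ξ)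
    (hx : star (ofFinsupp (actionC0 X G) π f) * ofFinsupp (actionC0 X G) π f =
      charProj π U hc ho)
    (hy : star (ofFinsupp (actionC0 X G) π g) * ofFinsupp (actionC0 X G) π g =
      charProj π U hc ho)
    (hle : ofFinsupp (actionC0 X G) π f * star (ofFinsupp (actionC0 X G) π f) +
      ofFinsupp (actionC0 X G) π g * star (ofFinsupp (actionC0 X G) π g) ≤
      charProj π U hc ho) :
    IsParadoxical G {V : Set X | IsOpen V} U := by
  obtain ⟨hpx, hpy, hxy⟩ := mul_eq_self_and_star_mul_eq_zero charProj_mul_self hx hle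
  have hxy' : star (ofFinsupp (actionC0 X G) π f) * ofFinsupp (actionC0 X G) π g =
      incl (actionC0 X G) π 0 := by
    rw [hxy, incl, Finsupp.single_zero, ofFinsupp_zero]
  -- The two families of group elements and coefficients are joined into one.
  let e := f.support.equivFin.symm
  let e' := g.support.equivFin.symm
  let t : Fin (f.support.card + g.support.card) → G :=
    Fin.append (fun i => (e i : G)) (fun j => (e' j : G))
  let a : Fin (f.support.card + g.support.card) → C₀(X, ℂ) :=
    Fin.append (fun i => f (e i)) (fun j => g (e' j))
  have ha : ∀ k, ∃ η, a k η ≠ 0 := by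
    intro k
    by_contra hcon
    push Not at hcon
    have h0 : a k = 0 := by ext η; exact hcon η
    revert h0
    refine Fin.addCases (fun i => ?_) (fun j => ?_) k
    · simpa [a] using Finsupp.mem_support_iff.1 (e i).2
    · simpa [a] using Finsupp.mem_support_iff.1 (e' j).2
  have hmul : Pairwise fun k l => ∀ η, a k η * a l η = 0 := by
    intro k l
    refine Fin.addCases (fun i => ?_) (fun j => ?_) k <;>
      refine Fin.addCases (fun i' => ?_) (fun j' => ?_) l
    · intro hne η
      simp only [a, Fin.append_left]
      refine mul_eq_zero_of_star_mul_eq_incl hπ hf hf hx (Or.inl fun h => hne ?_) η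
      rw [e.injective (Subtype.ext h)]
    · intro _ η
      simp only [a, Fin.append_left, Fin.append_right]
      exact mul_eq_zero_of_star_mul_eq_incl hπ hf hg hxy' (Or.inr rfl) η
    · intro _ η
      simp only [a, Fin.append_left, Fin.append_right]
      rw [mul_comm]
      exact mul_eq_zero_of_star_mul_eq_incl hπ hf hg hxy' (Or.inr rfl) η
    · intro hne η
      simp only [a, Fin.append_right]
      refine mul_eq_zero_of_star_mul_eq_incl hπ hg hg hy (Or.inl fun h => hne ?_) η
      rw [e'.injective (Subtype.ext h)]
  refine ⟨hU, f.support.card, g.support.card, fun k => {ξ | a k (t k • ξ) ≠ 0}, t, ?_, ?_, ?_,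
    ?_, ?_⟩
  · intro k
    refine ⟨?_, ?_⟩
    · exact isOpen_ne.preimage ((a k).continuous.comp (continuous_const_smul (t k)))
    · obtain ⟨η, hη⟩ := ha k
      exact ⟨(t k)⁻¹ • η, by simpa using hη⟩
  · simp only [a, t, Fin.append_left]
    rw [← iUnion_ne_zero_of_star_mul_self_eq_charProj hπ hx]
    exact e.surjective.iUnion_comp fun s : f.support => {ξ | f s ((s : G) • ξ) ≠ 0}
  · simp only [a, t, Fin.append_right]
    rw [← iUnion_ne_zero_of_star_mul_self_eq_charProj hπ hy]
    exact e'.surjective.iUnion_comp fun s : g.support => {ξ | g s ((s : G) • ξ) ≠ 0}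
  · intro k
    rw [smul_setOf_apply_smul_ne_zero]
    intro η
    refine Fin.addCases (fun i => ?_) (fun j => ?_) k
    · simp only [a, Fin.append_left]
      exact mem_of_charProj_mul_eq_self hπ hpx
    · simp only [a, Fin.append_right]
      exact mem_of_charProj_mul_eq_self hπ hpy
  · intro k l hkl
    simp only [smul_setOf_apply_smul_ne_zero]
    rw [Set.disjoint_left]
    intro η h1 h2
    exact mul_ne_zero h1 h2 (hmul hkl η)

/-! ### From paradoxical decompositions to isometries with positive coefficients -/

/-- Square roots of a partition of unity subordinate to a finite open cover of `U`, translated by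
the `t k`, are the coefficients of an isometry over `1_U`, provided the translated sets are
disjoint. -/
theorem exists_sum_star_mul_self_eq_charFun [LocallyCompactSpace X] (hc : IsCompact U)
    (ho : IsOpen U) {n : ℕ} {V : Fin n → Set X} (t : Fin n → G) (hV : ∀ k, IsOpen (V k))
    (hVU : ⋃ k, V k = U) :
    ∃ a : Fin n → C₀(X, ℂ), (∀ k ξ, 0 ≤ a k ξ) ∧ (∀ k ξ, a k ξ ≠ 0 → ξ ∈ t k • V k) ∧
      ∑ k, actionC0 X G (t k)⁻¹ (star (a k) * a k) = charFun U hc ho := by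
  classical
  obtain ⟨h, hsupp, hsum, hI, hcs⟩ :=
    exists_continuous_sum_one_of_isOpen_isCompact hV hc hVU.superset
  let b : Fin n → C₀(X, ℂ) := fun k =>
    { toFun := fun ξ => ((√(h k ξ) : ℝ) : ℂ)
      continuous_toFun := by fun_prop
      zero_at_infty' :=
        ((hcs k).comp_left (g := fun r : ℝ => ((√r : ℝ) : ℂ)) (by simp)).is_zero_at_infty }
  have hb : ∀ k ξ, b k ξ = ((√(h k ξ) : ℝ) : ℂ) := fun _ _ => rfl
  have hbV : ∀ k ξ, b k ξ ≠ 0 → ξ ∈ V k := by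
    intro k ξ hξ
    apply hsupp k
    apply subset_tsupport
    intro h0
    exact hξ (by rw [hb, h0]; simp)
  refine ⟨fun k => actionC0 X G (t k) (b k), fun k ξ => ?_, fun k ξ hξ => ?_, ?_⟩
  · rw [actionC0_apply, hb, Complex.zero_le_real]
    exact Real.sqrt_nonneg _
  · rw [Set.mem_smul_set_iff_inv_smul_mem]
    exact hbV k _ hξ
  · ext ξ
    have hterm : ∀ k, actionC0 X G (t k)⁻¹ (star (actionC0 X G (t k) (b k)) *
        actionC0 X G (t k) (b k)) ξ = ((h k ξ : ℝ) : ℂ) := by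
      intro k
      rw [actionC0_apply, ZeroAtInftyContinuousMap.mul_apply, ZeroAtInftyContinuousMap.star_apply,
        actionC0_apply, inv_inv, inv_smul_smul, hb, Complex.star_def, Complex.conj_ofReal,
        ← Complex.ofReal_mul, Real.mul_self_sqrt (hI k ξ).1]
    rw [sum_apply, charFun_apply]
    simp only [hterm]
    split_ifs with hξ
    · have := hsum hξ
      rw [← Complex.ofReal_sum]
      exact_mod_cast (by simpa using this : ∑ k, h k ξ = 1)
    · refine Finset.sum_eq_zero fun k _ => ?_
      have : b k ξ = 0 := by_contra fun h0 => hξ (hVU ▸ Set.mem_iUnion.2 ⟨k, hbV k ξ h0⟩)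
      rw [hb, Complex.ofReal_eq_zero, Real.sqrt_eq_zero (hI k ξ).1] at this
      rw [this, Complex.ofReal_zero]

theorem exists_isometries_of_isParadoxical [LocallyCompactSpace X]
    (π : C₀(X, ℂ) →⋆ₙₐ[ℂ] (H →L[ℂ] H)) (hc : IsCompact U) (ho : IsOpen U)
    (h : IsParadoxical G {V : Set X | IsOpen V} U) :
    ∃ x y : ReducedCrossedProduct (actionC0 X G) π,
      x ∈ posFiniteSums π ∧ y ∈ posFiniteSums π ∧
      star x * x = charProj π U hc ho ∧ star y * y = charProj π U hc ho ∧
      charProj π U hc ho * x = x ∧ charProj π U hc ho * y = y ∧ star x * y = 0 := by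
  classical
  obtain ⟨-, n, m, V, t, hV, hn, hm, hsub, hdisj⟩ := h
  obtain ⟨a, ha0, haV, hasum⟩ := exists_sum_star_mul_self_eq_charFun hc ho
    (fun i => t (Fin.castAdd m i)) (fun i => (hV _).1) hn
  obtain ⟨b, hb0, hbV, hbsum⟩ := exists_sum_star_mul_self_eq_charFun hc ho
    (fun j => t (Fin.natAdd n j)) (fun j => (hV _).1) hm
  -- Coefficients supported in different translates are orthogonal.
  have hzero : ∀ {k l : Fin (n + m)} {c d : C₀(X, ℂ)}, k ≠ l → (∀ ξ, c ξ ≠ 0 → ξ ∈ t k • V k) →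
      (∀ ξ, d ξ ≠ 0 → ξ ∈ t l • V l) → star c * d = 0 := by
    intro k l c d hkl hc hd
    ext ξ
    rw [ZeroAtInftyContinuousMap.mul_apply, ZeroAtInftyContinuousMap.star_apply]
    by_cases h1 : c ξ = 0
    · simp [h1]
    by_cases h2 : d ξ = 0
    · simp [h2]
    exact (Set.disjoint_left.1 (hdisj hkl) (hc ξ h1) (hd ξ h2)).elim
  have hself : ∀ {N : ℕ} (j : Fin N → Fin (n + m)) (c : Fin N → C₀(X, ℂ)),
      Function.Injective j → (∀ k ξ, c k ξ ≠ 0 → ξ ∈ t (j k) • V (j k)) →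
      ∑ k, actionC0 X G (t (j k))⁻¹ (star (c k) * c k) = charFun U hc ho →
      star (ofFinsupp (actionC0 X G) π (∑ k, Finsupp.single (t (j k)) (c k))) *
        ofFinsupp (actionC0 X G) π (∑ k, Finsupp.single (t (j k)) (c k)) =
          charProj π U hc ho := by
    intro N j c hj hcV hsum
    rw [ofFinsupp_sum, star_sum, Finset.sum_mul_sum]
    have : ∀ k, ∑ l, star (ofFinsupp (actionC0 X G) π (Finsupp.single (t (j k)) (c k))) *
        ofFinsupp (actionC0 X G) π (Finsupp.single (t (j l)) (c l)) =
        ofFinsupp (actionC0 X G) π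
          (Finsupp.single 1 (actionC0 X G (t (j k))⁻¹ (star (c k) * c k))) := by
      intro k
      rw [Finset.sum_eq_single k, star_ofFinsupp_single_mul_single, inv_mul_cancel]
      · intro l _ hl
        rw [star_ofFinsupp_single_mul_single, hzero (hj.ne hl.symm) (hcV k) (hcV l), map_zero,
          Finsupp.single_zero, ofFinsupp_zero]
      · simp
    simp only [this]
    rw [← ofFinsupp_sum, ← Finsupp.single_finsetSum, hsum]
    rfl
  have hrange : ∀ {N : ℕ} (j : Fin N → Fin (n + m)) (c : Fin N → C₀(X, ℂ)),
      (∀ k ξ, c k ξ ≠ 0 → ξ ∈ t (j k) • V (j k)) →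
      charProj π U hc ho * ofFinsupp (actionC0 X G) π (∑ k, Finsupp.single (t (j k)) (c k)) =
        ofFinsupp (actionC0 X G) π (∑ k, Finsupp.single (t (j k)) (c k)) := by
    intro N j c hcV
    rw [ofFinsupp_sum, Finset.mul_sum]
    refine Finset.sum_congr rfl fun k _ => ?_
    rw [charProj, incl, ofFinsupp_single_mul_single, one_mul, map_one, StarAlgEquiv.one_apply,
      (charFun_mul_eq_self_iff hc ho (c k)).2 fun ξ hξ => hsub _ (hcV k ξ hξ)]
  have hpos : ∀ {N : ℕ} (s : Fin N → G) (c : Fin N → C₀(X, ℂ)), (∀ k ξ, 0 ≤ c k ξ) →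
      ofFinsupp (actionC0 X G) π (∑ k, Finsupp.single (s k) (c k)) ∈ posFiniteSums π := by
    intro N s c hc0
    refine ⟨_, fun r ξ => ?_, rfl⟩
    rw [Finsupp.finsetSum_apply, sum_apply]
    refine Finset.sum_nonneg fun k _ => ?_
    rw [Finsupp.single_apply]
    split_ifs
    · exact hc0 k ξ
    · exact le_rfl
  refine ⟨_, _, hpos _ a ha0, hpos _ b hb0,
    hself _ a (Fin.castAdd_injective n m) haV hasum,
    hself _ b (Fin.natAdd_injective m n) hbV hbsum, hrange _ a haV, hrange _ b hbV, ?_⟩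
  rw [ofFinsupp_sum, ofFinsupp_sum, star_sum, Finset.sum_mul_sum]
  refine Finset.sum_eq_zero fun i _ => Finset.sum_eq_zero fun j _ => ?_
  have hne : Fin.castAdd m i ≠ Fin.natAdd n j := by
    intro h
    have := congrArg Fin.val h
    simp at this
    omega
  rw [star_ofFinsupp_single_mul_single, hzero hne (haV i) (hbV j), map_zero,
    Finsupp.single_zero, ofFinsupp_zero]

end Decomposition

end CrossedProduct

theorem mainTheorem6 {X G H : Type*} [TopologicalSpace X] [T2Space X] [LocallyCompactSpace X]
    [Group G] [MulAction G X] [ContinuousConstSMul G X]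
    [NormedAddCommGroup H] [InnerProductSpace ℂ H] [CompleteSpace H]
    (π : C₀(X, ℂ) →⋆ₙₐ[ℂ] (H →L[ℂ] H)) (hπ : Function.Injective π)
    (U : Set X) (hUc : IsCompact U) (hUo : IsOpen U) (hU : U.Nonempty) :
    (CrossedProduct.IsParadoxical G {V : Set X | IsOpen V} U ↔
      ∃ x y : CrossedProduct.ReducedCrossedProduct (CrossedProduct.actionC0 X G) π,
        x ∈ CrossedProduct.posFiniteSums π ∧ y ∈ CrossedProduct.posFiniteSums π ∧
        star x * x = CrossedProduct.charProj π U hUc hUo ∧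
        star y * y = CrossedProduct.charProj π U hUc hUo ∧
        x * star x + y * star y ≤ CrossedProduct.charProj π U hUc hUo) ∧
    (CrossedProduct.IsParadoxical G {V : Set X | IsOpen V} U →
      CrossedProduct.IsProperlyInfinite
        (CrossedProduct.charProj π U hUc hUo :
          CrossedProduct.ReducedCrossedProduct (CrossedProduct.actionC0 X G) π)) := by
  refine ⟨⟨fun h => ?_, ?_⟩, fun h => ?_⟩
  · obtain ⟨x, y, hxm, hym, hx, hy, hpx, hpy, hxy⟩ :=
      CrossedProduct.exists_isometries_of_isParadoxical π hUc hUo h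
    exact ⟨x, y, hxm, hym, hx, hy, CrossedProduct.mul_star_add_mul_star_le
      CrossedProduct.charProj_mul_self hx hy hpx hpy hxy⟩
  · rintro ⟨_, _, ⟨f, hf, rfl⟩, ⟨g, hg, rfl⟩, hx, hy, hle⟩
    exact CrossedProduct.isParadoxical_of_isometries hπ hU hf hg hx hy hle
  · obtain ⟨x, y, -, -, hx, hy, hpx, hpy, hxy⟩ :=
      CrossedProduct.exists_isometries_of_isParadoxical π hUc hUo h
    exact CrossedProduct.isProperlyInfinite_of_star_mul (CrossedProduct.charProj_ne_zero hπ hU)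
      hx hy hpx hpy hxy
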